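/- Let $m>0$ and $c\in\mathbb R$, let $b:\mathbb R^3\to\mathbb R^3$ be continuously differentiable with $\nabla\cdot b=0$, and let $\Phi:\mathbb R^3\to\mathbb R$ be twice continuously differentiable. Put $F=-c\nabla\Phi$, $\omega=c\,m^{-1}b$, $$\Omega(q)=\begin{bmatrix}0&\omega_3(q)&-\omega_2(q)\\-\omega_3(q)&0&\omega_1(q)\\\omega_2(q)&-\omega_1(q)&0\end{bmatrix},\qquad B(y)=\begin{bmatrix}0&I\\-I&m\Omega(q)\end{bmatrix}\quad\text{for } y=\begin{bmatrix}q\\p\end{bmatrix}\in\mathbb R^6,$$ and define on $\mathbb R^6$ the vector fields $$\mathcal T(y)=\begin{bmatrix}p/m\\0\end{bmatrix},\qquad \mathcal E(y)=\begin{bmatrix}0\\F(q)\end{bmatrix},\qquad \mathcal B(y)=\begin{bmatrix}0\\\Omega(q)p\end{bmatrix}.$$ A Poisson tensor on $\mathbb R^n$ is a differentiable, skew-symmetric matrix-valued function $B$ with $$\sum_{\ell}\Big(\frac{\partial B_{ij}}{\partial y_\ell}B_{\ell k}+\frac{\partial B_{jk}}{\partial y_\ell}B_{\ell i}+\frac{\partial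 B_{ki}}{\partial y_\ell}B_{\ell j}\Big)=0\quad\text{for all } i,j,k.$$ A Poisson system is an ODE $y'=B(y)\nabla H(y)$ with $B$ a Poisson tensor and $H$ a differentiable Hamiltonian. A differentiable map $f$ is a Poisson map for $B$ if $f'(y)\,B(y)\,f'(y)^{\sf T}=B(f(y))$ for all $y$, where $f'$ is the Jacobian matrix. Then the following hold. 1. The flow of a Poisson system is a Poisson map. That is, let $B$ be a $C^1$ Poisson tensor on $\mathbb R^n$, let $H$ be $C^2$, let $t\in\mathbb R$, and let $U\subseteq\mathbb R^n$ be open such that a solution $s\mapsto\varphi_s(y)$ of $y'=B(y)\nabla H(y)$ with $\varphi_0(y)=y$ exists between the times $0$ and $t$ for every $y\in U$. Then $\varphi_t$ is differentiable on $U$ and $\varphi_t'(y)B(y)\varphi_t'(y)^{\sf T}=B(\varphi_t(y))$ for all $y\in U$. 2. For the matrix $B$ defined by $b$ above, $y'=(\mathcal T+\mathcal B)(y)$ and $y'=\mathcal E(y)$ are Poisson systems with structure matrix $B$ and Hamiltonians $\frac{|p|^2}{2m}$ and $c\,\Phi(q)$, respectively. 3. The exact flows $\varphi_t^{\mathcal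 T+\mathcal B}$ and $\varphi_t^{\mathcal E}$ of these two systems exist for all $t\in\mathbb R$ and all initial values, are unique, and are Poisson maps for $B$ for every $t\in\mathbb R$. 4. The Strang-type one-step method $$\varphi_h=\varphi^{\mathcal E}_{h/2}\circ\varphi^{\mathcal T+\mathcal B}_h\circ\varphi^{\mathcal E}_{h/2}$$ is time-symmetric, that is, $\varphi_{-h}=(\varphi_h)^{-1}$ for all $h\in\mathbb R$, and $\varphi_h$ is a Poisson map for $B$ for every $h\in\mathbb R$. -/

import Mathlib

open scoped Matrix

noncomputable section

namespace ChargedParticle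

/-! General notions on the coordinate space `ι → ℝ` with `ι` finite. -/

/-- The gradient, as the vector of partial derivatives. -/
def grad {ι : Type} [Fintype ι] [DecidableEq ι] (H : (ι → ℝ) → ℝ) (y : ι → ℝ) : ι → ℝ :=
  fun i => fderiv ℝ H y (Pi.single i 1)

/-- The divergence of a vector field. -/
def divergence {ι : Type} [Fintype ι] [DecidableEq ι] (b : (ι → ℝ) → (ι → ℝ)) (q : ι → ℝ) : ℝ :=
  ∑ i, fderiv ℝ (fun x => b x i) q (Pi.single i 1)

/-- The Jacobian matrix `∂f/∂y`: its entry `(i, j)` is the `j`-th partial derivative of the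
`i`-th component. -/
def jacobian {ι : Type} [Fintype ι] [DecidableEq ι] (f : (ι → ℝ) → (ι → ℝ)) (y : ι → ℝ) :
    Matrix ι ι ℝ :=
  Matrix.of fun i j => fderiv ℝ f y (Pi.single j 1) i

/-- `B` is a Poisson tensor: a differentiable, skew-symmetric matrix-valued function that satisfies
the Jacobi identity. -/
structure IsPoissonTensor {ι : Type} [Fintype ι] [DecidableEq ι]
    (B : (ι → ℝ) → Matrix ι ι ℝ) : Prop where
  differentiable : ∀ i j, Differentiable ℝ (fun y => B y i j)
  skew : ∀ y, (B y)ᵀ = -B y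
  jacobi : ∀ y i j k,
    ∑ l, (fderiv ℝ (fun z => B z i j) y (Pi.single l 1) * B y l k
        + fderiv ℝ (fun z => B z j k) y (Pi.single l 1) * B y l i
        + fderiv ℝ (fun z => B z k i) y (Pi.single l 1) * B y l j) = 0

/-- The system `y' = X(y)` is the Poisson system with structure matrix `B` and
Hamiltonian `H`. -/
structure IsPoissonSystem {ι : Type} [Fintype ι] [DecidableEq ι]
    (B : (ι → ℝ) → Matrix ι ι ℝ) (H : (ι → ℝ) → ℝ) (X : (ι → ℝ) → (ι → ℝ)) : Prop where
  tensor : IsPoissonTensor B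
  differentiable : Differentiable ℝ H
  eq : ∀ y, X y = B y *ᵥ grad H y

/-- `f` is differentiable at `y` and its Jacobian matrix there satisfies the Poisson relation. -/
def IsPoissonMapAt {ι : Type} [Fintype ι] [DecidableEq ι]
    (B : (ι → ℝ) → Matrix ι ι ℝ) (f : (ι → ℝ) → (ι → ℝ)) (y : ι → ℝ) : Prop :=
  DifferentiableAt ℝ f y ∧ jacobian f y * B y * (jacobian f y)ᵀ = B (f y)

/-- `f` is a Poisson map for the structure matrix `B`. -/
def IsPoissonMap {ι : Type} [Fintype ι] [DecidableEq ι]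
    (B : (ι → ℝ) → Matrix ι ι ℝ) (f : (ι → ℝ) → (ι → ℝ)) : Prop :=
  ∀ y, IsPoissonMapAt B f y

/-- `φ` is the exact flow for all times: `t ↦ φ t y₀` solves `w' = X(w)`, `w(0) = y₀`. -/
def IsExactFlow {ι : Type} [Fintype ι] (X : (ι → ℝ) → (ι → ℝ))
    (φ : ℝ → (ι → ℝ) → (ι → ℝ)) : Prop :=
  ∀ y₀, φ 0 y₀ = y₀ ∧ ∀ t, HasDerivAt (fun s => φ s y₀) (X (φ t y₀)) t

/-- `φ` is the exact flow up to time `t` (of either sign) for the initial values in `U`. -/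
def IsExactFlowUpTo {ι : Type} [Fintype ι] (X : (ι → ℝ) → (ι → ℝ))
    (φ : ℝ → (ι → ℝ) → (ι → ℝ)) (U : Set (ι → ℝ)) (t : ℝ) : Prop :=
  ∀ y₀ ∈ U, φ 0 y₀ = y₀ ∧ ∀ s ∈ Set.uIcc 0 t,
    HasDerivWithinAt (fun r => φ r y₀) (X (φ s y₀)) (Set.uIcc 0 t) s

/-- Time symmetry of a one-step method: `φ (-h)` is the two-sided inverse of `φ h`. -/
def IsTimeSymmetric {α : Type} (φ : ℝ → α → α) : Prop :=
  ∀ h, Function.LeftInverse (φ (-h)) (φ h) ∧ Function.RightInverse (φ (-h)) (φ h)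

/-- The Strang composition `φ_{h/2} ∘ ψ_h ∘ φ_{h/2}`. -/
def strang {α : Type} (φ ψ : ℝ → α → α) (h : ℝ) : α → α :=
  φ (h / 2) ∘ ψ h ∘ φ (h / 2)

/-! The charged particle: mass `m`, charge `c`, magnetic field `b`, electric potential `Φ`. -/

/-- The space of positions (or momenta), `ℝ³`. -/
abbrev Vec3 : Type := Fin 3 → ℝ

/-- The phase space `ℝ⁶` of the points `y = (q, p)`. -/
abbrev Phase : Type := Fin 3 ⊕ Fin 3 → ℝ

/-- The position part of `y = (q, p)`. -/
def pos (y : Phase) : Vec3 := fun i => y (Sum.inl i)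

/-- The momentum part of `y = (q, p)`. -/
def mom (y : Phase) : Vec3 := fun i => y (Sum.inr i)

/-- `ω(q) = c m⁻¹ b(q)`. -/
def omega (m c : ℝ) (b : Vec3 → Vec3) (q : Vec3) : Vec3 := (c * m⁻¹) • b q

/-- The matrix `Ω(q)` of the map `p ↦ p × ω(q)`. -/
def Omega (m c : ℝ) (b : Vec3 → Vec3) (q : Vec3) : Matrix (Fin 3) (Fin 3) ℝ :=
  !![0, omega m c b q 2, -omega m c b q 1;
     -omega m c b q 2, 0, omega m c b q 0;
     omega m c b q 1, -omega m c b q 0, 0]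

/-- The structure matrix `B(y) = [[0, I], [-I, mΩ(q)]]`. -/
def structureMatrix (m c : ℝ) (b : Vec3 → Vec3) (y : Phase) :
    Matrix (Fin 3 ⊕ Fin 3) (Fin 3 ⊕ Fin 3) ℝ :=
  Matrix.fromBlocks 0 1 (-1) (m • Omega m c b (pos y))

/-- The electric force `F(q) = -c ∇Φ(q)`. -/
def force (c : ℝ) (Φ : Vec3 → ℝ) (q : Vec3) : Vec3 := -(c • grad Φ q)

/-- The field `𝒯(q, p) = (p / m, 0)`. -/
def fieldT (m : ℝ) (y : Phase) : Phase := Sum.elim (m⁻¹ • mom y) 0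

/-- The field `ℰ(q, p) = (0, F(q))`. -/
def fieldE (c : ℝ) (Φ : Vec3 → ℝ) (y : Phase) : Phase := Sum.elim 0 (force c Φ (pos y))

/-- The field `ℬ(q, p) = (0, Ω(q) p)`. -/
def fieldB (m c : ℝ) (b : Vec3 → Vec3) (y : Phase) : Phase :=
  Sum.elim 0 (Omega m c b (pos y) *ᵥ mom y)

/-- The kinetic energy `|p|² / (2m)`, with the Euclidean norm. -/
def kinetic (m : ℝ) (y : Phase) : ℝ := (∑ i, mom y i ^ 2) / (2 * m)

/-- The potential energy `c Φ(q)`. -/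
def potential (c : ℝ) (Φ : Vec3 → ℝ) (y : Phase) : ℝ := c * Φ (pos y)

end ChargedParticle

end

/-!
The theorem has three sources: differentiability of flows in the initial value, the invariance of a
Poisson tensor under Hamiltonian flows, and the fact that a magnetic force does no work.

*Differentiability of the flow* (`hasFDerivAt_flow`). Only `C¹` fields and trajectories on a compact
time interval, rescaled to `[0, 1]`, occur. Along a trajectory `γ` the linear variational equation
`M' = X'(γ) M`, `M(0) = 1` has a solution (`exists_fundamental_solution`). Nearby trajectories stay
within a constant times their initial distance of `γ` (`flow_lipschitz`), so the error
`φ_s(y) - γ(s) - M(s)(y - y₀)` satisfies the variational equation up to a term `o(‖y - y₀‖)`, and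
Grönwall's inequality shows that `M(1)` is the derivative of `φ_1` at `y₀`. Existence, here and for
the magnetic flow, comes from the Picard-Lindelöf theorem for a field cut off outside a ball that an
a priori bound prevents the solution from leaving (`exists_solution_of_apriori_bound`).

*Poisson maps* (`isPoissonMapAt_flow`). Let `X = B∇H`, and let `A` be the Jacobian matrix of `X`.
The Jacobi identity and the symmetry of the Hessian of `H` give `dB[X] = AB + BAᵀ`
(`IsPoissonSystem.fderiv_tensor`). With `J` the matrix of `M`, both `J B(y) Jᵀ` and `B(γ)` then
solve the linear equation `Z' = AZ + ZAᵀ`, with the same initial value, so they are equal.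

*The charged particle.* The Jacobi identity for the structure matrix is `∇·b = 0`
(`cyclic_fderiv_Omega`). The flow of `ℰ` is explicit. Under `𝒯 + ℬ` the norm of the momentum is
conserved, because `p · Ω(q)p = 0`, and the position grows at most linearly, so that solutions are
global (`exists_solution_fieldTB`). Time symmetry of the Strang composition is the group property of
the two flows, and Poisson maps are closed under composition by the chain rule.
-/

open scoped Matrix

namespace ChargedParticle

open Set Metric Filter
open scoped NNReal Topology

/-! ### Existence and uniqueness of solutions -/

section ODE

variable {E : Type*} [NormedAddCommGroup E] [NormedSpace ℝ E]

/-- A continuously differentiable field is Lipschitz on every ball of a finite-dimensional space. -/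
theorem exists_lipschitzOnWith_closedBall [FiniteDimensional ℝ E] {X : E → E}
    (hX : ContDiff ℝ 1 X) (R : ℝ) : ∃ K : ℝ≥0, LipschitzOnWith K X (closedBall 0 R) := by
  have := FiniteDimensional.proper ℝ E
  exact hX.contDiffOn.exists_lipschitzOnWith one_ne_zero (convex_closedBall 0 R)
    (isCompact_closedBall 0 R)

/-- A bounded, globally Lipschitz field has a solution on any compact time interval. -/
theorem exists_solution_of_bounded [CompleteSpace E] {f : ℝ → E → E} {a b : ℝ}
    (h0 : (0 : ℝ) ∈ Icc a b) (hcont : ∀ x, Continuous fun t => f t x) {K L : ℝ≥0}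
    (hlip : ∀ t ∈ Icc a b, LipschitzWith K (f t)) (hL : ∀ t ∈ Icc a b, ∀ x, ‖f t x‖ ≤ L)
    (x₀ : E) :
    ∃ α : ℝ → E, α 0 = x₀ ∧ ∀ t ∈ Icc a b, HasDerivWithinAt α (f t (α t)) (Icc a b) t := by
  have hpos : 0 ≤ max (b - 0) (0 - a) := le_max_of_le_left (by linarith [h0.2])
  have hPL : IsPicardLindelof f (⟨0, h0⟩ : Icc a b) x₀ (L * .mk _ hpos) 0 L K :=
    { lipschitzOnWith := fun t ht => (hlip t ht).lipschitzOnWith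
      continuousOn := fun x _ => (hcont x).continuousOn
      norm_le := fun t ht x _ => hL t ht x
      mul_max_le := by simp }
  exact hPL.exists_eq_forall_mem_Icc_hasDerivWithinAt₀

/-- A Lipschitz, bounded scaling map `x ↦ χ x • x` that is the identity on a given ball. -/
theorem exists_cutoff [FiniteDimensional ℝ E] (R : ℝ) :
    ∃ (χ : E → ℝ) (K : ℝ≥0) (R' : ℝ), (∀ x, χ x ∈ Icc (0 : ℝ) 1) ∧
      (∀ x, ‖x‖ ≤ R → χ x = 1) ∧ LipschitzWith K (fun x => χ x • x) ∧ ∀ x, ‖χ x • x‖ ≤ R' := by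
  have hR : (0 : ℝ) < |R| + 1 := by positivity
  let χ : ContDiffBump (0 : E) := ⟨|R| + 1, |R| + 2, hR, by linarith⟩
  have hsupp : HasCompactSupport fun x : E => χ x • x := by
    have := χ.hasCompactSupport
    exact this.smul_right (f' := fun x => x)
  have hdiff : ContDiff ℝ 1 fun x : E => χ x • x := χ.contDiff.smul contDiff_id
  obtain ⟨K, hK⟩ := ContDiff.lipschitzWith_of_hasCompactSupport hsupp hdiff one_ne_zero
  obtain ⟨C, hC⟩ := hsupp.exists_bound_of_continuous hdiff.continuous
  refine ⟨χ, K, C, fun x => ⟨χ.nonneg, χ.le_one⟩, fun x hx => ?_, hK, hC⟩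
  apply χ.one_of_mem_closedBall
  simp only [mem_closedBall, dist_zero_right, χ]
  linarith [le_abs_self R]

/-- Global existence from an a priori bound. The bound is required for all the fields
`x ↦ f t (c t • x)` with `0 ≤ c ≤ 1`: the solution is first found for a field cut off outside a
large ball, and the bound shows that it never leaves the ball. -/
theorem exists_solution_of_apriori_bound [FiniteDimensional ℝ E] {f : ℝ → E → E} {a b : ℝ}
    (h0 : (0 : ℝ) ∈ Icc a b) (hcont : ∀ x, Continuous fun t => f t x)
    (hlip : ∀ R, ∃ K : ℝ≥0, ∀ t ∈ Icc a b, LipschitzOnWith K (f t) (closedBall 0 R))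
    {x₀ : E} (R : ℝ)
    (hbound : ∀ (α : ℝ → E) (c : ℝ → ℝ), (∀ t, c t ∈ Icc (0 : ℝ) 1) → α 0 = x₀ →
      (∀ t ∈ Icc a b, HasDerivWithinAt α (f t (c t • α t)) (Icc a b) t) →
      ∀ t ∈ Icc a b, ‖α t‖ ≤ R) :
    ∃ α : ℝ → E, α 0 = x₀ ∧ ∀ t ∈ Icc a b, HasDerivWithinAt α (f t (α t)) (Icc a b) t := by
  have := FiniteDimensional.complete ℝ E
  obtain ⟨χ, Kχ, R', hχ, hχ1, hχK, hχR⟩ := exists_cutoff (E := E) R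
  have hR' : 0 ≤ R' := (norm_nonneg _).trans (hχR 0)
  obtain ⟨K, hK⟩ := hlip R'
  have hmem : ∀ x, χ x • x ∈ closedBall (0 : E) R' := fun x => by simpa using hχR x
  obtain ⟨C, hC⟩ := isCompact_Icc.exists_bound_of_continuousOn
    (s := Icc a b) (hcont 0).continuousOn
  have hC0 : 0 ≤ C := (norm_nonneg _).trans (hC 0 h0)
  obtain ⟨α, hα0, hα⟩ := exists_solution_of_bounded (f := fun t x => f t (χ x • x)) h0
    (fun x => hcont _) (K := K * Kχ) (L := K * .mk R' hR' + .mk C hC0)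
    (fun t ht => by
      have := (hK t ht).comp (hχK.lipschitzOnWith (s := univ)) (fun x _ => hmem x)
      exact lipschitzOnWith_univ.1 this)
    (fun t ht x => by
      have h1 := (hK t ht).norm_sub_le (hmem x) (by simpa using hR' : (0 : E) ∈ closedBall 0 R')
      have h2 : ‖f t (χ x • x)‖ ≤ ‖f t (χ x • x) - f t 0‖ + ‖f t 0‖ := norm_le_norm_sub_add _ _
      have h3 : (K : ℝ) * ‖χ x • x - 0‖ ≤ K * R' := by
        rw [sub_zero]; gcongr; exact hχR x
      have := hC t ht
      push_cast
      linarith) x₀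
  refine ⟨α, hα0, fun t ht => ?_⟩
  have := hα t ht
  rwa [hχ1 _ (hbound α (fun t => χ (α t)) (fun t => hχ _) hα0 hα t ht), one_smul] at this

/-- Two solutions of the autonomous equation of a `C¹` field which agree at time `0` agree
throughout. -/
theorem solution_unique [FiniteDimensional ℝ E] {X : E → E} (hX : ContDiff ℝ 1 X) {T : ℝ}
    {α β : ℝ → E}
    (hα : ∀ t ∈ Icc 0 T, HasDerivWithinAt α (X (α t)) (Icc 0 T) t)
    (hβ : ∀ t ∈ Icc 0 T, HasDerivWithinAt β (X (β t)) (Icc 0 T) t)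
    (h : α 0 = β 0) : EqOn α β (Icc 0 T) := by
  have hαc : ContinuousOn α (Icc 0 T) := fun t ht => (hα t ht).continuousWithinAt
  have hβc : ContinuousOn β (Icc 0 T) := fun t ht => (hβ t ht).continuousWithinAt
  obtain ⟨R₁, h₁⟩ := isCompact_Icc.exists_bound_of_continuousOn hαc
  obtain ⟨R₂, h₂⟩ := isCompact_Icc.exists_bound_of_continuousOn hβc
  obtain ⟨K, hK⟩ := exists_lipschitzOnWith_closedBall hX (max R₁ R₂)
  refine ODE_solution_unique_of_mem_Icc_right (v := fun _ => X)
    (s := fun _ => closedBall 0 (max R₁ R₂)) (fun _ _ => hK) hαc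
    (fun t ht => (hα t (Ico_subset_Icc_self ht)).mono_of_mem_nhdsWithin
      (Icc_mem_nhdsGE_of_mem ht))
    (fun t ht => ?_) hβc
    (fun t ht => (hβ t (Ico_subset_Icc_self ht)).mono_of_mem_nhdsWithin
      (Icc_mem_nhdsGE_of_mem ht))
    (fun t ht => ?_) h
  · simpa using Or.inl (h₁ t (Ico_subset_Icc_self ht))
  · simpa using Or.inr (h₂ t (Ico_subset_Icc_self ht))

/-- The two-sided version of `solution_unique`. -/
theorem solution_unique_symm [FiniteDimensional ℝ E] {X : E → E} (hX : ContDiff ℝ 1 X) {T : ℝ}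
    {α β : ℝ → E}
    (hα : ∀ t ∈ Icc (-T) T, HasDerivWithinAt α (X (α t)) (Icc (-T) T) t)
    (hβ : ∀ t ∈ Icc (-T) T, HasDerivWithinAt β (X (β t)) (Icc (-T) T) t)
    (h : α 0 = β 0) : EqOn α β (Icc (-T) T) := by
  intro t ht
  have hT : 0 ≤ T := by linarith [ht.1, ht.2]
  have hsub : Icc 0 T ⊆ Icc (-T) T := Icc_subset_Icc_left (by linarith)
  have hmaps : MapsTo Neg.neg (Icc 0 T) (Icc (-T) T) := fun s hs =>
    ⟨by linarith [hs.2], by linarith [hs.1]⟩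
  rcases le_total 0 t with h0 | h0
  · exact solution_unique hX (fun s hs => (hα s (hsub hs)).mono hsub)
      (fun s hs => (hβ s (hsub hs)).mono hsub) h ⟨h0, ht.2⟩
  · -- Backward in time, the reversed curves solve the equation of `-X`.
    have key : ∀ γ : ℝ → E, (∀ t ∈ Icc (-T) T,
        HasDerivWithinAt γ (X (γ t)) (Icc (-T) T) t) → ∀ s ∈ Icc 0 T,
        HasDerivWithinAt (fun s => γ (-s)) ((-X) (γ (-s))) (Icc 0 T) s := fun γ hγ s hs => by
      simpa [Function.comp_def] using
        (hγ (-s) (hmaps hs)).scomp s (hasDerivAt_neg s).hasDerivWithinAt hmaps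
    have := solution_unique hX.neg (key α hα) (key β hβ) (by simpa using h)
      (show -t ∈ Icc 0 T from ⟨by linarith, by linarith [ht.1]⟩)
    simpa using this

/-- Global solutions of the equation of a `C¹` field are determined by their value at time `0`. -/
theorem global_solution_unique [FiniteDimensional ℝ E] {X : E → E} (hX : ContDiff ℝ 1 X)
    {α β : ℝ → E} (hα : ∀ t, HasDerivAt α (X (α t)) t) (hβ : ∀ t, HasDerivAt β (X (β t)) t)
    (h : α 0 = β 0) : α = β :=
  funext fun t => solution_unique_symm hX (T := |t|) (fun s _ => (hα s).hasDerivWithinAt)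
    (fun s _ => (hβ s).hasDerivWithinAt) h ⟨neg_abs_le t, le_abs_self t⟩

/-- Solutions on all bounded time intervals fit together to a global solution. -/
theorem exists_global_solution [FiniteDimensional ℝ E] {X : E → E} (hX : ContDiff ℝ 1 X)
    {x₀ : E} (h : ∀ T, 0 < T → ∃ α : ℝ → E, α 0 = x₀ ∧
      ∀ t ∈ Icc (-T) T, HasDerivWithinAt α (X (α t)) (Icc (-T) T) t) :
    ∃ α : ℝ → E, α 0 = x₀ ∧ ∀ t, HasDerivAt α (X (α t)) t := by
  choose! α hα0 hα using h
  have hagree : ∀ S T t, 0 < S → S ≤ T → t ∈ Icc (-S) S → α S t = α T t := by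
    intro S T t hS hST ht
    have hsub : Icc (-S) S ⊆ Icc (-T) T := Icc_subset_Icc (by linarith) hST
    have hT := hS.trans_le hST
    exact solution_unique_symm hX (hα S hS) (fun s hs => (hα T hT s (hsub hs)).mono hsub)
      (by rw [hα0 S hS, hα0 T hT]) ht
  have hγ : ∀ T t, |t| + 1 ≤ T → α (|t| + 1) t = α T t := fun T t hT =>
    hagree _ _ _ (by positivity) hT
      ⟨by linarith [neg_abs_le t], by linarith [le_abs_self t]⟩
  refine ⟨fun t => α (|t| + 1) t, hα0 _ (by positivity), fun t => ?_⟩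
  have h1 : HasDerivAt (α (|t| + 2)) (X (α (|t| + 2) t)) t :=
    (hα (|t| + 2) (by positivity) t
      ⟨by linarith [neg_abs_le t], by linarith [le_abs_self t]⟩).hasDerivAt
      (Icc_mem_nhds (by linarith [neg_abs_le t]) (by linarith [le_abs_self t]))
  have h2 : ∀ᶠ s in 𝓝 t, |s| < |t| + 1 :=
    continuous_abs.continuousAt.eventually (gt_mem_nhds (by linarith))
  have h3 : (fun s => α (|s| + 1) s) =ᶠ[𝓝 t] α (|t| + 2) :=
    h2.mono fun s hs => hγ _ s (by linarith)
  have h4 := h1.congr_of_eventuallyEq h3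
  rwa [← hγ (|t| + 2) t (by linarith)] at h4

/-- The Grönwall inequality on `[0, 1]` for one-sided derivatives within the interval. -/
theorem norm_le_gronwallBound_unitInterval {f f' : ℝ → E} {δ K ε : ℝ}
    (hf : ∀ t ∈ Icc (0 : ℝ) 1, HasDerivWithinAt f (f' t) (Icc 0 1) t) (h0 : ‖f 0‖ ≤ δ)
    (bound : ∀ t ∈ Icc (0 : ℝ) 1, ‖f' t‖ ≤ K * ‖f t‖ + ε) :
    ∀ t ∈ Icc (0 : ℝ) 1, ‖f t‖ ≤ gronwallBound δ K ε t := by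
  have := norm_le_gronwallBound_of_norm_deriv_right_le (f := f) (f' := f') (δ := δ) (K := K)
    (ε := ε) (a := 0) (b := 1) (fun t ht => (hf t ht).continuousWithinAt)
    (fun t ht => (hf t (Ico_subset_Icc_self ht)).mono_of_mem_nhdsWithin
      (Icc_mem_nhdsGE_of_mem ht)) h0 (fun t ht => bound t (Ico_subset_Icc_self ht))
  simpa using this

/-- A linear equation with continuous coefficients has a solution on the whole interval. -/
theorem exists_fundamental_solution [FiniteDimensional ℝ E] {A : ℝ → E →L[ℝ] E}
    (hA : ContinuousOn A (Icc 0 1)) :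
    ∃ M : ℝ → E →L[ℝ] E, M 0 = ContinuousLinearMap.id ℝ E ∧
      ∀ t ∈ Icc (0 : ℝ) 1, HasDerivWithinAt M (A t ∘L M t) (Icc 0 1) t := by
  obtain ⟨C, hC⟩ := isCompact_Icc.exists_bound_of_continuousOn hA
  have hC0 : 0 ≤ C := (norm_nonneg _).trans (hC 0 (by simp))
  -- The coefficients are extended to all times by their values at the end points.
  let A' : ℝ → E →L[ℝ] E := IccExtend zero_le_one ((Icc 0 1).domRestrict A)
  have hA' : Continuous A' := hA.domRestrict.Icc_extend' (h := zero_le_one)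
  have hAA' : ∀ t ∈ Icc (0 : ℝ) 1, A' t = A t := fun t ht => by
    simp [A', IccExtend_of_mem zero_le_one _ ht, Set.domRestrict]
  obtain ⟨M, hM0, hM⟩ := exists_solution_of_apriori_bound
    (E := E →L[ℝ] E) (f := fun t M => A' t ∘L M) (a := 0) (b := 1)
    (x₀ := ContinuousLinearMap.id ℝ E) (by simp) (fun M => hA'.clm_comp continuous_const)
    (fun R => ⟨.mk C hC0, fun t ht => LipschitzOnWith.of_dist_le_mul fun x _ y _ => by
      rw [dist_eq_norm, dist_eq_norm, ← ContinuousLinearMap.comp_sub, hAA' t ht]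
      exact (ContinuousLinearMap.opNorm_comp_le _ _).trans
        (mul_le_mul_of_nonneg_right (hC t ht) (norm_nonneg _))⟩)
    (‖ContinuousLinearMap.id ℝ E‖ * Real.exp C)
    (fun α c hc hα0 hα t ht => by
      have := norm_le_gronwallBound_unitInterval (K := C) (ε := 0) hα le_rfl ?_ t ht
      · rw [gronwallBound_ε0] at this
        rw [hα0] at this
        refine this.trans ?_
        gcongr
        nlinarith [ht.2]
      · intro t ht
        rw [hAA' t ht, add_zero]
        refine (ContinuousLinearMap.opNorm_comp_le _ _).trans ?_
        refine mul_le_mul (hC t ht) ?_ (norm_nonneg _) hC0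
        rw [norm_smul, Real.norm_of_nonneg (hc t).1]
        exact mul_le_of_le_one_left (norm_nonneg _) (hc t).2)
  exact ⟨M, hM0, fun t ht => by simpa only [hAA' t ht] using hM t ht⟩

end ODE

/-! ### Differentiability of the flow in the initial value -/

section FlowDerivative

variable {E : Type*} [NormedAddCommGroup E] [NormedSpace ℝ E] [FiniteDimensional ℝ E]
  {X : E → E} {φ : ℝ → E → E} {U : Set E}

/-- A flow of a `C¹` field depends on the initial value in a Lipschitz way near every point, with
a constant that is uniform in time. -/
theorem flow_lipschitz (hX : ContDiff ℝ 1 X) (hU : IsOpen U)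
    (hφ : ∀ y ∈ U, φ 0 y = y ∧
      ∀ s ∈ Icc (0 : ℝ) 1, HasDerivWithinAt (fun r => φ r y) (X (φ s y)) (Icc 0 1) s)
    {y₀ : E} (hy₀ : y₀ ∈ U) :
    ∃ C : ℝ, 0 < C ∧
      ∀ᶠ y in 𝓝 y₀, ∀ s ∈ Icc (0 : ℝ) 1, ‖φ s y - φ s y₀‖ ≤ C * ‖y - y₀‖ := by
  have := FiniteDimensional.complete ℝ E
  have := FiniteDimensional.proper ℝ E
  obtain ⟨R₀, hR₀⟩ := isCompact_Icc.exists_bound_of_continuousOn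
    (fun t ht => ((hφ y₀ hy₀).2 t ht).continuousWithinAt)
  obtain ⟨χ, Kχ, R', hχ, hχ1, hχK, hχR⟩ := exists_cutoff (E := E) (R₀ + 1)
  obtain ⟨K, hK⟩ := exists_lipschitzOnWith_closedBall hX R'
  have hmem : ∀ x, χ x • x ∈ closedBall (0 : E) R' := fun x => by simpa using hχR x
  obtain ⟨B, hB⟩ := (isCompact_closedBall (0 : E) R').exists_bound_of_continuousOn
    hX.continuous.continuousOn
  have hB0 : 0 ≤ B := (norm_nonneg _).trans (hB _ (hmem 0))
  have hY : LipschitzWith (K * Kχ) fun x => X (χ x • x) :=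
    lipschitzOnWith_univ.1 (hK.comp (hχK.lipschitzOnWith (s := univ)) fun x _ => hmem x)
  refine ⟨Real.exp (K * Kχ : ℝ≥0), Real.exp_pos _, ?_⟩
  have hnear : ∀ᶠ y in 𝓝 y₀, Real.exp (K * Kχ : ℝ≥0) * ‖y - y₀‖ < 1 := by
    have : Continuous fun y => Real.exp (K * Kχ : ℝ≥0) * ‖y - y₀‖ := by fun_prop
    exact this.continuousAt.eventually (gt_mem_nhds (by simp))
  filter_upwards [hnear, hU.mem_nhds hy₀] with y hy hyU
  obtain ⟨β, hβ0, hβ⟩ := exists_solution_of_bounded (f := fun _ x => X (χ x • x))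
    (a := 0) (b := 1) (by simp) (fun x => continuous_const) (L := .mk B hB0)
    (fun _ _ => hY) (fun _ _ x => hB _ (hmem x)) y
  -- The solution of the cut-off equation stays close to the given trajectory, hence in the ball
  -- where nothing has been cut off.
  have hclose : ∀ s ∈ Icc (0 : ℝ) 1,
      ‖β s - φ s y₀‖ ≤ Real.exp (K * Kχ : ℝ≥0) * ‖y - y₀‖ := by
    intro s hs
    have := norm_le_gronwallBound_unitInterval (f := fun s => β s - φ s y₀) (δ := ‖y - y₀‖)
      (K := (K * Kχ : ℝ≥0)) (ε := 0)
      (fun t ht => (hβ t ht).sub ((hφ y₀ hy₀).2 t ht))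
      (by rw [hβ0, (hφ y₀ hy₀).1])
      (fun t ht => by
        have h1 := hY.norm_sub_le (β t) (φ t y₀)
        have h2 : χ (φ t y₀) = 1 := hχ1 _ (by linarith [hR₀ t ht])
        simp only [h2, one_smul] at h1
        rwa [add_zero]) s hs
    rw [gronwallBound_ε0, mul_comm] at this
    refine this.trans ?_
    gcongr
    exact mul_le_of_le_one_right (by positivity) hs.2
  have hβX : ∀ t ∈ Icc (0 : ℝ) 1, HasDerivWithinAt β (X (β t)) (Icc 0 1) t := fun t ht => by
    have h1 : ‖β t‖ ≤ R₀ + 1 := by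
      have h2 : ‖β t‖ ≤ ‖β t - φ t y₀‖ + ‖φ t y₀‖ := norm_le_norm_sub_add _ _
      linarith [hclose t ht, hR₀ t ht]
    simpa [hχ1 _ h1] using hβ t ht
  intro s hs
  have : β s = φ s y :=
    solution_unique hX hβX (hφ y hyU).2 (by rw [hβ0, (hφ y hyU).1]) hs
  rw [← this]
  exact hclose s hs

/-- The linearization of a `C¹` field is accurate uniformly on bounded sets. -/
theorem uniform_linearization (hX : ContDiff ℝ 1 X) (R : ℝ) {ε : ℝ} (hε : 0 < ε) :
    ∃ δ > 0, ∀ x z : E, ‖x‖ ≤ R → ‖z - x‖ ≤ δ →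
      ‖X z - X x - fderiv ℝ X x (z - x)‖ ≤ ε * ‖z - x‖ := by
  have := FiniteDimensional.proper ℝ E
  have huc : UniformContinuousOn (fderiv ℝ X) (closedBall 0 (R + 1)) :=
    (isCompact_closedBall 0 (R + 1)).uniformContinuousOn_of_continuous
      (hX.continuous_fderiv one_ne_zero).continuousOn
  obtain ⟨δ, hδ, h⟩ := Metric.uniformContinuousOn_iff_le.1 huc ε hε
  refine ⟨min δ 1, by positivity, fun x z hx hz => ?_⟩
  have hball : ∀ w ∈ closedBall x ‖z - x‖, ‖w‖ ≤ R + 1 ∧ ‖w - x‖ ≤ δ := fun w hw => by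
    rw [mem_closedBall_iff_norm] at hw
    have h2 : ‖w‖ ≤ ‖w - x‖ + ‖x‖ := norm_le_norm_sub_add _ _
    have h3 := hz.trans (min_le_right _ _)
    have h4 := hz.trans (min_le_left _ _)
    constructor <;> linarith
  refine (convex_closedBall x ‖z - x‖).norm_image_sub_le_of_norm_fderiv_le'
    (𝕜 := ℝ) (f := X) (φ := fderiv ℝ X x) (C := ε)
    (fun w _ => (hX.differentiable one_ne_zero) w) (fun w hw => ?_)
    (mem_closedBall_self (norm_nonneg _)) (mem_closedBall_iff_norm.2 le_rfl)
  rw [← dist_eq_norm]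
  exact h w (by simpa using (hball w hw).1) x (by simp; linarith)
    (by simpa [dist_eq_norm] using (hball w hw).2)

/-- The flow of a `C¹` field is differentiable in the initial value, and its derivative solves the
variational equation along the trajectory. -/
theorem hasFDerivAt_flow (hX : ContDiff ℝ 1 X) (hU : IsOpen U)
    (hφ : ∀ y ∈ U, φ 0 y = y ∧
      ∀ s ∈ Icc (0 : ℝ) 1, HasDerivWithinAt (fun r => φ r y) (X (φ s y)) (Icc 0 1) s)
    {y₀ : E} (hy₀ : y₀ ∈ U) :
    ∃ M : ℝ → E →L[ℝ] E, M 0 = ContinuousLinearMap.id ℝ E ∧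
      (∀ s ∈ Icc (0 : ℝ) 1,
        HasDerivWithinAt M (fderiv ℝ X (φ s y₀) ∘L M s) (Icc 0 1) s) ∧
      HasFDerivAt (φ 1) (M 1) y₀ := by
  have hγ : ContinuousOn (fun s => φ s y₀) (Icc 0 1) :=
    fun t ht => ((hφ y₀ hy₀).2 t ht).continuousWithinAt
  obtain ⟨R, hR⟩ := isCompact_Icc.exists_bound_of_continuousOn hγ
  have hA : ContinuousOn (fun s => fderiv ℝ X (φ s y₀)) (Icc 0 1) :=
    (hX.continuous_fderiv one_ne_zero).comp_continuousOn hγ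
  obtain ⟨M, hM0, hM⟩ := exists_fundamental_solution hA
  refine ⟨M, hM0, hM, ?_⟩
  obtain ⟨K₀, hK₀⟩ := isCompact_Icc.exists_bound_of_continuousOn hA
  let K := max K₀ 1
  have hK : 0 < K := lt_max_of_lt_right one_pos
  have hKA : ∀ s ∈ Icc (0 : ℝ) 1, ‖fderiv ℝ X (φ s y₀)‖ ≤ K :=
    fun s hs => (hK₀ s hs).trans (le_max_left _ _)
  obtain ⟨C, hC, hCφ⟩ := flow_lipschitz hX hU hφ hy₀
  rw [hasFDerivAt_iff_isLittleO, Asymptotics.isLittleO_iff]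
  intro c hc
  have hexp : 0 < Real.exp K := Real.exp_pos _
  -- The error of the linearization is `ε` times the distance of the trajectories; Grönwall
  -- multiplies it by at most `exp K / K`.
  let ε := c * K / (C * Real.exp K)
  have hε : 0 < ε := by positivity
  obtain ⟨δ, hδ, hlin⟩ := uniform_linearization hX R hε
  have hnear : ∀ᶠ y in 𝓝 y₀, C * ‖y - y₀‖ < δ := by
    have : Continuous fun y => C * ‖y - y₀‖ := by fun_prop
    exact this.continuousAt.eventually (gt_mem_nhds (by simpa using hδ))
  filter_upwards [hCφ, hnear, hU.mem_nhds hy₀] with y hy hyδ hyU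
  have key := norm_le_gronwallBound_unitInterval (δ := 0) (K := K) (ε := ε * (C * ‖y - y₀‖))
    (f := fun s => φ s y - φ s y₀ - M s (y - y₀))
    (fun t ht => (((hφ y hyU).2 t ht).sub ((hφ y₀ hy₀).2 t ht)).sub
      ((hM t ht).clm_apply (hasDerivWithinAt_const t _ (y - y₀))))
    (by simp [(hφ y hyU).1, (hφ y₀ hy₀).1, hM0])
    (fun t ht => by
      have h1 := hlin (φ t y₀) (φ t y) (hR t ht) ((hy t ht).trans hyδ.le)
      have h2 : X (φ t y) - X (φ t y₀) -
          ((fderiv ℝ X (φ t y₀) ∘L M t) (y - y₀) + M t 0) =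
          fderiv ℝ X (φ t y₀) (φ t y - φ t y₀ - M t (y - y₀)) +
          (X (φ t y) - X (φ t y₀) - fderiv ℝ X (φ t y₀) (φ t y - φ t y₀)) := by
        simp
      rw [h2]
      refine (norm_add_le _ _).trans (add_le_add ?_ (h1.trans ?_))
      · exact (ContinuousLinearMap.le_opNorm _ _).trans
          (mul_le_mul_of_nonneg_right (hKA t ht) (norm_nonneg _))
      · exact mul_le_mul_of_nonneg_left (hy t ht) hε.le)
    1 (by simp)
  refine key.trans ?_
  rw [gronwallBound_of_K_ne_0 hK.ne']
  simp only [zero_mul, mul_one, zero_add]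
  calc ε * (C * ‖y - y₀‖) / K * (Real.exp K - 1)
      ≤ ε * (C * ‖y - y₀‖) / K * Real.exp K := by gcongr; linarith
    _ = c * ‖y - y₀‖ := by simp only [ε]; field_simp

end FlowDerivative

/-! ### Hamiltonian flows preserve the Poisson tensor -/

section PoissonFlow

variable {ι : Type} [Fintype ι]

/-- The algebra behind the invariance of a Poisson tensor `b` along a Hamiltonian flow. With
`d i j l = ∂_l B_ij`, `h = ∇H` and `S = ∇²H`, the left side is the derivative of `B_ij` along
`B∇H`, and the sums on the right are the entries of `AB + BAᵀ` for the Jacobian matrix `A` of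
`B∇H`. The Hessian terms cancel by symmetry, the others by the Jacobi identity. -/
theorem lie_derivative_algebra {b S : ι → ι → ℝ} {d : ι → ι → ι → ℝ} {h : ι → ℝ}
    (hb : ∀ i j, b i j = -b j i) (hd : ∀ i j l, d i j l = -d j i l) (hS : ∀ k l, S k l = S l k)
    (hJ : ∀ i j k, ∑ l, (d i j l * b l k + d j k l * b l i + d k i l * b l j) = 0) (i j : ι) :
    ∑ l, d i j l * ∑ k, b l k * h k =
      ∑ l, (∑ k, (d i k l * h k + b i k * S l k)) * b l j +
      ∑ l, b i l * ∑ k, (d j k l * h k + b j k * S l k) := by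
  have hL : ∑ l, d i j l * ∑ k, b l k * h k = ∑ k, (∑ l, d i j l * b l k) * h k := by
    simp only [Finset.mul_sum, Finset.sum_mul]
    rw [Finset.sum_comm]
    simp only [mul_assoc]
  have h1 : ∑ l, (∑ k, (d i k l * h k + b i k * S l k)) * b l j =
      ∑ k, (∑ l, d i k l * b l j) * h k + ∑ l, ∑ k, b i k * S l k * b l j := by
    simp only [Finset.sum_add_distrib, add_mul, Finset.sum_mul]
    congr 1
    rw [Finset.sum_comm]
    exact Finset.sum_congr rfl fun _ _ => Finset.sum_congr rfl fun _ _ => by ring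
  have h2 : ∑ l, b i l * ∑ k, (d j k l * h k + b j k * S l k) =
      ∑ k, (∑ l, b i l * d j k l) * h k + ∑ l, ∑ k, b i l * (b j k * S l k) := by
    simp only [Finset.sum_add_distrib, mul_add, Finset.mul_sum, Finset.sum_mul]
    congr 1
    rw [Finset.sum_comm]
    exact Finset.sum_congr rfl fun _ _ => Finset.sum_congr rfl fun _ _ => by ring
  have h3 : ∑ l, ∑ k, b i k * S l k * b l j = -∑ l, ∑ k, b i l * (b j k * S l k) := by
    rw [Finset.sum_comm, ← Finset.sum_neg_distrib]
    refine Finset.sum_congr rfl fun l _ => ?_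
    rw [← Finset.sum_neg_distrib]
    refine Finset.sum_congr rfl fun k _ => ?_
    rw [hb k j, hS k l]
    ring
  have h4 : ∀ k, ∑ l, d i j l * b l k = ∑ l, d i k l * b l j + ∑ l, b i l * d j k l := fun k => by
    have h5 := hJ i j k
    have h6 : ∑ l, d i k l * b l j = -∑ l, d k i l * b l j := by
      rw [← Finset.sum_neg_distrib]
      exact Finset.sum_congr rfl fun l _ => by rw [hd i k]; ring
    have h7 : ∑ l, b i l * d j k l = -∑ l, d j k l * b l i := by
      rw [← Finset.sum_neg_distrib]
      exact Finset.sum_congr rfl fun l _ => by rw [hb i l]; ring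
    simp only [Finset.sum_add_distrib] at h5
    linarith
  rw [hL, h1, h2, h3]
  simp only [h4, add_mul, Finset.sum_add_distrib]
  ring

/-- A matrix-valued solution of `D' = AD + DAᵀ` on `[0, 1]` with bounded `A` and `D(0) = 0`
vanishes. -/
theorem matrix_eq_zero_of_linear_ode {A D : ℝ → Matrix ι ι ℝ} {a : ℝ}
    (hA : ∀ s ∈ Icc (0 : ℝ) 1, ∀ i j, |A s i j| ≤ a) (h0 : D 0 = 0)
    (hD : ∀ s ∈ Icc (0 : ℝ) 1, ∀ i j,
      HasDerivWithinAt (fun r => D r i j) ((A s * D s + D s * (A s)ᵀ) i j) (Icc 0 1) s) :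
    D 1 = 0 := by
  -- The sup norm of `ι → ι → ℝ` is used on matrices.
  let F : ℝ → ι → ι → ℝ := fun s i j => D s i j
  rcases isEmpty_or_nonempty ι with hι | ⟨⟨i₀⟩⟩
  · ext i; exact hι.elim i
  have ha : 0 ≤ a := (abs_nonneg _).trans (hA 0 (by simp) i₀ i₀)
  have hentry : ∀ s i j, |D s i j| ≤ ‖F s‖ := fun s i j =>
    (norm_le_pi_norm (F s i) j).trans (norm_le_pi_norm (F s) i)
  have key := norm_le_gronwallBound_unitInterval (f := F) (δ := 0)
    (f' := fun s i j => (A s * D s + D s * (A s)ᵀ) i j)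
    (K := Fintype.card ι * (2 * a)) (ε := 0)
    (fun s hs => hasDerivWithinAt_pi.2 fun i => hasDerivWithinAt_pi.2 fun j => hD s hs i j)
    (by
      have : F 0 = 0 := by funext i j; simp [F, h0]
      simp [this])
    (fun s hs => by
      rw [add_zero]
      have hR : 0 ≤ Fintype.card ι * (2 * a) * ‖F s‖ := by positivity
      refine (pi_norm_le_iff_of_nonneg hR).2 fun i => (pi_norm_le_iff_of_nonneg hR).2 fun j => ?_
      rw [Matrix.add_apply, Matrix.mul_apply, Matrix.mul_apply, ← Finset.sum_add_distrib]
      refine (norm_sum_le _ _).trans ?_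
      have : ∀ k ∈ Finset.univ, ‖A s i k * D s k j + D s i k * (A s)ᵀ k j‖ ≤ 2 * a * ‖F s‖ := by
        intro k _
        refine (norm_add_le _ _).trans ?_
        rw [norm_mul, norm_mul, Matrix.transpose_apply]
        have h1 := mul_le_mul (hA s hs i k) (hentry s k j) (abs_nonneg _) ha
        have h2 := mul_le_mul (hentry s i k) (hA s hs j k) (abs_nonneg _) (norm_nonneg _)
        simp only [Real.norm_eq_abs]
        linarith
      refine (Finset.sum_le_card_nsmul _ _ _ this).trans ?_
      simp [mul_assoc])
    1 (by simp)
  rw [gronwallBound_ε0_δ0] at key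
  have hF : F 1 = 0 := norm_le_zero_iff.1 key
  ext i j
  exact congrFun (congrFun hF i) j

/-- The derivative of `J K Jᵀ` when `J' = AJ` and `K` is constant. -/
theorem hasDerivWithinAt_conj {J : ℝ → Matrix ι ι ℝ} {A : Matrix ι ι ℝ} (K : Matrix ι ι ℝ)
    {t : Set ℝ} {s : ℝ}
    (hJ : ∀ i j, HasDerivWithinAt (fun r => J r i j) ((A * J s) i j) t s) (i j : ι) :
    HasDerivWithinAt (fun r => (J r * K * (J r)ᵀ) i j)
      ((A * (J s * K * (J s)ᵀ) + J s * K * (J s)ᵀ * Aᵀ) i j) t s := by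
  have h1 : (A * (J s * K * (J s)ᵀ) + J s * K * (J s)ᵀ * Aᵀ) i j =
      ∑ l, ((∑ k, (A * J s) i k * K k l) * J s j l + (∑ k, J s i k * K k l) * (A * J s) j l) := by
    have : A * (J s * K * (J s)ᵀ) + J s * K * (J s)ᵀ * Aᵀ =
        (A * J s) * K * (J s)ᵀ + J s * K * (A * J s)ᵀ := by
      rw [Matrix.transpose_mul]
      simp only [Matrix.mul_assoc]
    rw [this, Matrix.add_apply, Matrix.mul_apply, Matrix.mul_apply, ← Finset.sum_add_distrib]
    simp only [Matrix.mul_apply (M := A * J s) (N := K), Matrix.mul_apply (M := J s) (N := K),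
      Matrix.transpose_apply]
  rw [h1]
  have h2 : (fun r => (J r * K * (J r)ᵀ) i j) =
      fun r => ∑ l, (∑ k, J r i k * K k l) * J r j l := by
    funext r
    simp only [Matrix.mul_apply, Matrix.transpose_apply]
  rw [h2]
  exact HasDerivWithinAt.fun_sum fun l _ =>
    (HasDerivWithinAt.fun_sum fun k _ => (hJ i k).mul_const (K k l)).mul (hJ j l)

variable [DecidableEq ι]

theorem jacobian_mulVec (f : (ι → ℝ) → ι → ℝ) (y v : ι → ℝ) :
    jacobian f y *ᵥ v = fderiv ℝ f y v := by
  funext i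
  conv_rhs => rw [pi_eq_sum_univ' v]
  simp only [Matrix.mulVec, dotProduct, jacobian, Matrix.of_apply, map_sum, map_smul,
    Finset.sum_apply, Pi.smul_apply, smul_eq_mul, mul_comm]

theorem jacobian_apply {f : (ι → ℝ) → ι → ℝ} {y : ι → ℝ} (hf : DifferentiableAt ℝ f y)
    (i l : ι) : jacobian f y i l = fderiv ℝ (fun z => f z i) y (Pi.single l 1) := by
  rw [fderiv_apply hf]
  rfl

theorem fderiv_eq_sum (g : (ι → ℝ) → ℝ) (y v : ι → ℝ) :
    fderiv ℝ g y v = ∑ l, fderiv ℝ g y (Pi.single l 1) * v l := by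
  conv_lhs => rw [pi_eq_sum_univ' v]
  simp [map_sum, mul_comm]

theorem contDiff_grad {H : (ι → ℝ) → ℝ} (hH : ContDiff ℝ 2 H) : ContDiff ℝ 1 (grad H) :=
  contDiff_pi.2 fun _ => (hH.fderiv_right (by norm_num)).clm_apply contDiff_const

variable {B : (ι → ℝ) → Matrix ι ι ℝ} {H : (ι → ℝ) → ℝ} {X : (ι → ℝ) → (ι → ℝ)}

theorem IsPoissonSystem.contDiff (hB : ∀ i j, ContDiff ℝ 1 (fun y => B y i j))
    (hH : ContDiff ℝ 2 H) (h : IsPoissonSystem B H X) : ContDiff ℝ 1 X := by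
  have : X = fun y i => ∑ k, B y i k * grad H y k := funext fun y => h.eq y
  rw [this]
  exact contDiff_pi.2 fun i => ContDiff.sum fun k _ =>
    (hB i k).mul (contDiff_pi.1 (contDiff_grad hH) k)

/-- The Lie derivative of a Poisson tensor along a Hamiltonian field vanishes. -/
theorem IsPoissonSystem.fderiv_tensor (hB : ∀ i j, ContDiff ℝ 1 (fun y => B y i j))
    (hH : ContDiff ℝ 2 H) (h : IsPoissonSystem B H X) (y : ι → ℝ) (i j : ι) :
    fderiv ℝ (fun z => B z i j) y (X y) =
      (jacobian X y * B y + B y * (jacobian X y)ᵀ) i j := by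
  have hX := h.contDiff hB hH
  have hBd : ∀ i j, DifferentiableAt ℝ (fun z => B z i j) y := fun i j =>
    (hB i j).differentiable one_ne_zero y
  have hskew : ∀ z i j, B z i j = -B z j i := fun z i j => by
    simpa using congrFun (congrFun (h.tensor.skew z) j) i
  have hA : ∀ i l, jacobian X y i l = ∑ k, (fderiv ℝ (fun z => B z i k) y (Pi.single l 1) *
      grad H y k + B y i k * fderiv ℝ (fderiv ℝ H) y (Pi.single l 1) (Pi.single k 1)) := by
    intro i l
    rw [jacobian_apply (hX.differentiable one_ne_zero y)]
    have hXi : (fun z => X z i) = fun z => ∑ k, B z i k * grad H z k :=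
      funext fun z => congrFun (h.eq z) i
    have hg : ∀ k, DifferentiableAt ℝ (fun z => grad H z k) y := fun k =>
      (contDiff_pi.1 (contDiff_grad hH) k).differentiable one_ne_zero y
    have hdd : DifferentiableAt ℝ (fderiv ℝ H) y :=
      (hH.fderiv_right (m := 1) (by norm_num)).differentiable one_ne_zero y
    rw [hXi, fderiv_fun_sum fun k _ => (hBd i k).fun_mul (hg k)]
    rw [sum_apply]
    refine Finset.sum_congr rfl fun k _ => ?_
    rw [fderiv_fun_mul (hBd i k) (hg k)]
    have : fderiv ℝ (fun z => grad H z k) y (Pi.single l 1) =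
        fderiv ℝ (fderiv ℝ H) y (Pi.single l 1) (Pi.single k 1) := by
      simp only [grad]
      rw [fderiv_clm_apply hdd (differentiableAt_const _)]
      simp
    simp only [add_apply, smul_apply, smul_eq_mul, this]
    ring
  have key := lie_derivative_algebra (b := B y)
    (S := fun l k => fderiv ℝ (fderiv ℝ H) y (Pi.single l 1) (Pi.single k 1))
    (d := fun i j l => fderiv ℝ (fun z => B z i j) y (Pi.single l 1)) (h := grad H y)
    (hskew y) (fun i j l => by
      have : (fun z => B z i j) = fun z => -B z j i := funext fun z => hskew z i j
      simp only [this, fderiv_fun_neg, neg_apply])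
    (fun k l => hH.contDiffAt.isSymmSndFDerivAt (by simp) _ _)
    (fun i j k => h.tensor.jacobi y i j k) i j
  rw [fderiv_eq_sum, h.eq y]
  simp only [Matrix.add_apply, Matrix.mul_apply, Matrix.transpose_apply, hA]
  exact key

/-- The time-one map of the flow of a Poisson system is a Poisson map. -/
theorem isPoissonMapAt_flow_one (hB : ∀ i j, ContDiff ℝ 1 (fun y => B y i j))
    (hH : ContDiff ℝ 2 H) (h : IsPoissonSystem B H X) {φ : ℝ → (ι → ℝ) → (ι → ℝ)}
    {U : Set (ι → ℝ)} (hU : IsOpen U)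
    (hφ : ∀ y ∈ U, φ 0 y = y ∧
      ∀ s ∈ Icc (0 : ℝ) 1, HasDerivWithinAt (fun r => φ r y) (X (φ s y)) (Icc 0 1) s)
    {y : ι → ℝ} (hy : y ∈ U) : IsPoissonMapAt B (φ 1) y := by
  have hX := h.contDiff hB hH
  obtain ⟨M, hM0, hM, hM1⟩ := hasFDerivAt_flow hX hU hφ hy
  refine ⟨hM1.differentiableAt, ?_⟩
  let J : ℝ → Matrix ι ι ℝ := fun s => Matrix.of fun i j => M s (Pi.single j 1) i
  have hJ1 : jacobian (φ 1) y = J 1 := by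
    simp only [jacobian, hM1.fderiv, J]
  have hJ0 : J 0 = 1 := by
    ext i j
    simp [J, hM0, Matrix.one_apply, Pi.single_apply]
  have hJ : ∀ s ∈ Icc (0 : ℝ) 1, ∀ i j,
      HasDerivWithinAt (fun r => J r i j) ((jacobian X (φ s y) * J s) i j) (Icc 0 1) s := by
    intro s hs i j
    have h1 := (hM s hs).clm_apply (hasDerivWithinAt_const s _ (Pi.single j (1 : ℝ)))
    have h2 := hasDerivWithinAt_pi.1 h1 i
    convert! h2 using 1
    rw [map_zero, add_zero, ContinuousLinearMap.comp_apply, ← jacobian_mulVec]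
    rfl
  have hγ : ContinuousOn (fun s => φ s y) (Icc 0 1) :=
    fun t ht => ((hφ y hy).2 t ht).continuousWithinAt
  obtain ⟨a, ha⟩ := isCompact_Icc.exists_bound_of_continuousOn
    ((hX.continuous_fderiv one_ne_zero).comp_continuousOn hγ)
  have key := matrix_eq_zero_of_linear_ode (A := fun s => jacobian X (φ s y))
    (D := fun s => J s * B y * (J s)ᵀ - B (φ s y)) (a := a)
    (fun s hs i j => by
      refine (norm_le_pi_norm (fderiv ℝ X (φ s y) (Pi.single j 1)) i).trans ?_
      refine (ContinuousLinearMap.le_opNorm _ _).trans ?_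
      rw [Pi.norm_single, norm_one, mul_one]
      exact ha s hs)
    (by simp [hJ0, (hφ y hy).1])
    (fun s hs i j => by
      have h1 := hasDerivWithinAt_conj (B y) (hJ s hs) i j
      have h2 := (((hB i j).differentiable one_ne_zero (φ s y)).hasFDerivAt).comp_hasDerivWithinAt
        s ((hφ y hy).2 s hs)
      rw [h.fderiv_tensor hB hH] at h2
      convert! h1.sub h2 using 1
      simp only [mul_sub, sub_mul, Matrix.add_apply, Matrix.sub_apply]
      ring)
  rw [hJ1]
  exact sub_eq_zero.1 key

/-- The flow of a Poisson system consists of Poisson maps. -/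
theorem isPoissonMapAt_flow (hB : ∀ i j, ContDiff ℝ 1 (fun y => B y i j))
    (hH : ContDiff ℝ 2 H) (h : IsPoissonSystem B H X) {φ : ℝ → (ι → ℝ) → (ι → ℝ)}
    {U : Set (ι → ℝ)} (hU : IsOpen U) {t : ℝ} (hφ : IsExactFlowUpTo X φ U t)
    {y : ι → ℝ} (hy : y ∈ U) : IsPoissonMapAt B (φ t) y := by
  -- Time is rescaled to `[0, 1]`, which multiplies the Hamiltonian by `t`, whatever its sign.
  have hgrad : ∀ z, grad (fun z => t * H z) z = t • grad H z := fun z => by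
    funext i
    simp [grad, fderiv_const_mul (hH.differentiable two_ne_zero z)]
  have ht : IsPoissonSystem B (fun z => t * H z) (t • X) :=
    { tensor := h.tensor
      differentiable := h.differentiable.const_mul t
      eq := fun z => by rw [hgrad, Matrix.mulVec_smul, ← h.eq, Pi.smul_apply] }
  have hmaps : MapsTo (fun s : ℝ => t * s) (Icc 0 1) (uIcc 0 t) := fun s hs => by
    rcases le_total 0 t with h0 | h0
    · rw [uIcc_of_le h0]; exact ⟨by nlinarith [hs.1], by nlinarith [hs.2]⟩
    · rw [uIcc_of_ge h0]; exact ⟨by nlinarith [hs.2], by nlinarith [hs.1]⟩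
  have := isPoissonMapAt_flow_one hB (contDiff_const.mul hH) ht hU
    (φ := fun s => φ (t * s)) (fun y hy => ⟨by simpa using (hφ y hy).1, fun s hs => by
      have h1 := (hφ y hy).2 (t * s) (hmaps hs)
      have h2 : HasDerivWithinAt (fun s : ℝ => t * s) t (Icc 0 1) s := by
        simpa using (hasDerivWithinAt_id s (Icc 0 1)).const_mul t
      exact h1.scomp s h2 hmaps⟩) hy
  simpa using this

end PoissonFlow

/-! ### Composition, inversion and uniqueness of flows -/

section Flows

variable {ι : Type} [Fintype ι]

/-- The time-`-t` map of the flow of a `C¹` field inverts the time-`t` map. -/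
theorem IsExactFlow.leftInverse {X : (ι → ℝ) → (ι → ℝ)} (hX : ContDiff ℝ 1 X)
    {φ : ℝ → (ι → ℝ) → (ι → ℝ)} (hφ : IsExactFlow X φ) (t : ℝ) :
    Function.LeftInverse (φ (-t)) (φ t) := by
  intro y
  have h := global_solution_unique hX (α := fun s => φ s (φ t y)) (β := fun s => φ (s + t) y)
    (fun s => (hφ (φ t y)).2 s) (fun s => ((hφ y).2 (s + t)).comp_add_const s t)
    (by simp [(hφ (φ t y)).1])
  simpa [(hφ y).1] using congrFun h (-t)

/-- The flow of a `C¹` field is unique, and exists as soon as all solutions are global. -/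
theorem existsUnique_isExactFlow {X : (ι → ℝ) → (ι → ℝ)} (hX : ContDiff ℝ 1 X)
    (h : ∀ y₀, ∃ α : ℝ → ι → ℝ, α 0 = y₀ ∧ ∀ t, HasDerivAt α (X (α t)) t) :
    ∃! φ, IsExactFlow X φ := by
  choose α hα0 hα using h
  refine ⟨fun t y => α y t, fun y => ⟨hα0 y, hα y⟩, fun ψ hψ => ?_⟩
  funext t y
  exact congrFun (global_solution_unique hX (hψ y).2 (hα y) (by rw [(hψ y).1, hα0])) t

theorem IsExactFlow.upTo {X : (ι → ℝ) → (ι → ℝ)} {φ : ℝ → (ι → ℝ) → (ι → ℝ)}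
    (hφ : IsExactFlow X φ) (t : ℝ) : IsExactFlowUpTo X φ univ t :=
  fun y _ => ⟨(hφ y).1, fun s _ => ((hφ y).2 s).hasDerivWithinAt⟩

theorem isTimeSymmetric_strang {α : Type} {φ ψ : ℝ → α → α}
    (hφ : ∀ t, Function.LeftInverse (φ (-t)) (φ t))
    (hψ : ∀ t, Function.LeftInverse (ψ (-t)) (ψ t)) : IsTimeSymmetric (strang φ ψ) := by
  have key : ∀ h, Function.LeftInverse (strang φ ψ (-h)) (strang φ ψ h) := fun h x => by
    simp only [strang, Function.comp_apply, neg_div]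
    rw [hφ, hψ, hφ]
  exact fun h => ⟨key h, fun x => by simpa using key (-h) x⟩

variable [DecidableEq ι]

theorem jacobian_comp {f g : (ι → ℝ) → ι → ℝ} {y : ι → ℝ} (hf : DifferentiableAt ℝ f (g y))
    (hg : DifferentiableAt ℝ g y) :
    jacobian (f ∘ g) y = jacobian f (g y) * jacobian g y := by
  ext i j
  have h : fderiv ℝ (f ∘ g) y (Pi.single j 1) =
      jacobian f (g y) *ᵥ fderiv ℝ g y (Pi.single j 1) := by
    rw [fderiv_comp y hf hg, jacobian_mulVec]
    rfl
  exact congrFun h i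

theorem IsPoissonMap.comp {B : (ι → ℝ) → Matrix ι ι ℝ} {f g : (ι → ℝ) → (ι → ℝ)}
    (hf : IsPoissonMap B f) (hg : IsPoissonMap B g) : IsPoissonMap B (f ∘ g) := by
  intro y
  refine ⟨(hf (g y)).1.comp y (hg y).1, ?_⟩
  rw [jacobian_comp (hf (g y)).1 (hg y).1, Matrix.transpose_mul, Function.comp_apply,
    ← (hf (g y)).2, ← (hg y).2]
  simp only [Matrix.mul_assoc]

end Flows

/-! ### The charged particle -/

section Particle

variable {m c : ℝ} {b : Vec3 → Vec3} {Φ : Vec3 → ℝ}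

theorem contDiff_pos {n : WithTop ℕ∞} : ContDiff ℝ n pos :=
  contDiff_pi.2 fun i => contDiff_apply ℝ ℝ (Sum.inl i)

/-- The derivative of a function of the position alone. -/
theorem fderiv_comp_pos {g : Vec3 → ℝ} {y : Phase} (hg : DifferentiableAt ℝ g (pos y))
    (v : Phase) : fderiv ℝ (fun z => g (pos z)) y v = fderiv ℝ g (pos y) (pos v) := by
  let L : Phase →L[ℝ] Vec3 := ContinuousLinearMap.pi fun i => ContinuousLinearMap.proj (Sum.inl i)
  have hp : HasFDerivAt pos L y := L.hasFDerivAt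
  have h : HasFDerivAt (fun z => g (pos z)) (fderiv ℝ g (pos y) ∘L L) y :=
    hg.hasFDerivAt.comp y hp
  rw [h.fderiv]
  rfl

theorem pos_single_inl (l : Fin 3) : pos (Pi.single (Sum.inl l) 1) = Pi.single l 1 := by
  funext i
  simp [pos, Pi.single_apply]

theorem pos_single_inr (l : Fin 3) : pos (Pi.single (Sum.inr l) 1) = 0 := by
  funext i
  simp [pos]

theorem contDiff_Omega (hb : ContDiff ℝ 1 b) (i j : Fin 3) :
    ContDiff ℝ 1 fun q => Omega m c b q i j := by
  have h : ∀ k, ContDiff ℝ 1 fun q => omega m c b q k := fun k =>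
    contDiff_const.mul (contDiff_pi.1 hb k)
  fin_cases i <;> fin_cases j <;>
    simp [Omega, contDiff_const, h, (h _).neg]

theorem contDiff_structureMatrix (hb : ContDiff ℝ 1 b) (i j : Fin 3 ⊕ Fin 3) :
    ContDiff ℝ 1 fun y => structureMatrix m c b y i j := by
  rcases i with i | i <;> rcases j with j | j
  · exact contDiff_const
  · exact contDiff_const
  · exact contDiff_const
  · exact contDiff_const.mul ((contDiff_Omega hb i j).comp contDiff_pos)

theorem Omega_transpose (q : Vec3) : (Omega m c b q)ᵀ = -Omega m c b q := by
  ext i j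
  fin_cases i <;> fin_cases j <;> simp [Omega]

/-- The Jacobi identity for the momentum block is the condition `∇·b = 0`. -/
theorem cyclic_fderiv_Omega (hb : ContDiff ℝ 1 b) (hdiv : ∀ q, divergence b q = 0) (q : Vec3)
    (i j k : Fin 3) :
    fderiv ℝ (fun q => Omega m c b q i j) q (Pi.single k 1) +
      fderiv ℝ (fun q => Omega m c b q j k) q (Pi.single i 1) +
      fderiv ℝ (fun q => Omega m c b q k i) q (Pi.single j 1) = 0 := by
  have hd : ∀ k, DifferentiableAt ℝ (fun q => b q k) q := fun k =>
    (contDiff_pi.1 hb k).differentiable one_ne_zero q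
  have h1 : ∀ k v, fderiv ℝ (fun q => omega m c b q k) q v =
      c * m⁻¹ * fderiv ℝ (fun q => b q k) q v := fun k v => by
    simp only [omega, Pi.smul_apply, smul_eq_mul]
    rw [fderiv_const_mul (hd k)]
    rfl
  have h2 : ∀ i j v, fderiv ℝ (fun q => Omega m c b q i j) q v =
      (!![0, fderiv ℝ (fun q => omega m c b q 2) q v, -fderiv ℝ (fun q => omega m c b q 1) q v;
        -fderiv ℝ (fun q => omega m c b q 2) q v, 0, fderiv ℝ (fun q => omega m c b q 0) q v;
        fderiv ℝ (fun q => omega m c b q 1) q v, -fderiv ℝ (fun q => omega m c b q 0) q v, 0] :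
        Matrix (Fin 3) (Fin 3) ℝ) i j := fun i j v => by
    fin_cases i <;> fin_cases j <;> simp [Omega]
  have h3 := hdiv q
  simp only [divergence, Fin.sum_univ_three] at h3
  simp only [h2, h1]
  fin_cases i <;> fin_cases j <;> fin_cases k <;> simp <;>
    first
      | linear_combination (c * m⁻¹) * h3
      | linear_combination -(c * m⁻¹) * h3

theorem structureMatrix_inl_inl (y : Phase) (i j : Fin 3) :
    structureMatrix m c b y (Sum.inl i) (Sum.inl j) = 0 := rfl

theorem structureMatrix_inl_inr (y : Phase) (i j : Fin 3) :
    structureMatrix m c b y (Sum.inl i) (Sum.inr j) = (1 : Matrix (Fin 3) (Fin 3) ℝ) i j := rfl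

theorem structureMatrix_inr_inl (y : Phase) (i j : Fin 3) :
    structureMatrix m c b y (Sum.inr i) (Sum.inl j) = -(1 : Matrix (Fin 3) (Fin 3) ℝ) i j := rfl

theorem structureMatrix_inr_inr (y : Phase) (i j : Fin 3) :
    structureMatrix m c b y (Sum.inr i) (Sum.inr j) = m * Omega m c b (pos y) i j := rfl

/-- Only the position derivatives of the momentum block can be nonzero; for indices in that block
the identity block of the matrix picks them out, and `cyclic_fderiv_Omega` applies. -/
theorem isPoissonTensor_structureMatrix (hb : ContDiff ℝ 1 b)
    (hdiv : ∀ q, divergence b q = 0) : IsPoissonTensor (structureMatrix m c b) where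
  differentiable i j := (contDiff_structureMatrix hb i j).differentiable one_ne_zero
  skew y := by
    simp [structureMatrix, Matrix.fromBlocks_transpose, Matrix.fromBlocks_neg, Omega_transpose]
  jacobi y i j k := by
    have hd : ∀ i j v, fderiv ℝ (fun z => m * Omega m c b (pos z) i j) y v =
        m * fderiv ℝ (fun q => Omega m c b q i j) (pos y) (pos v) := fun i j v => by
      have h1 := (contDiff_Omega (m := m) (c := c) hb i j).differentiable one_ne_zero (pos y)
      rw [fderiv_comp_pos (g := fun q => m * Omega m c b q i j) (h1.const_mul m),
        fderiv_const_mul h1]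
      rfl
    rcases i with i | i <;> rcases j with j | j <;> rcases k with k | k <;>
      simp only [Fintype.sum_sum_type, structureMatrix_inl_inl, structureMatrix_inl_inr,
        structureMatrix_inr_inl, structureMatrix_inr_inr, hd, pos_single_inl, pos_single_inr,
        fderiv_fun_const, map_zero, Pi.zero_apply, zero_apply, zero_mul, mul_zero, add_zero,
        Finset.sum_const_zero]
    have := cyclic_fderiv_Omega (m := m) (c := c) hb hdiv (pos y) i j k
    simp only [Finset.sum_add_distrib, Matrix.one_apply, mul_ite, mul_one, mul_zero,
      Finset.sum_ite_eq', Finset.mem_univ, if_true]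
    linear_combination m * this

theorem contDiff_kinetic {n : WithTop ℕ∞} : ContDiff ℝ n (kinetic m) :=
  (ContDiff.sum fun i _ => (contDiff_apply ℝ ℝ (Sum.inr i)).pow 2).div_const _

theorem grad_kinetic (y : Phase) : grad (kinetic m) y = Sum.elim (0 : Vec3) (m⁻¹ • mom y) := by
  have h : HasFDerivAt (kinetic m)
      ((2 * m)⁻¹ • ∑ i : Fin 3, (2 * y (Sum.inr i)) •
        (ContinuousLinearMap.proj (Sum.inr i) : Phase →L[ℝ] ℝ)) y := by
    have h1 : ∀ i ∈ Finset.univ, HasFDerivAt (fun y : Phase => mom y i ^ 2)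
        ((2 * y (Sum.inr i)) • (ContinuousLinearMap.proj (Sum.inr i) : Phase →L[ℝ] ℝ)) y := by
      intro i _
      simpa [mom] using (hasFDerivAt_apply (𝕜 := ℝ) (Sum.inr i : Fin 3 ⊕ Fin 3) y).pow 2
    have h2 := (HasFDerivAt.fun_sum h1).const_mul (2 * m)⁻¹
    refine h2.congr_of_eventuallyEq (Eventually.of_forall fun z => ?_)
    simp only [kinetic, div_eq_inv_mul]
  funext i
  simp only [grad, h.fderiv]
  rcases i with i | i
  · simp
  · simp [Pi.single_apply, mom]
    ring

theorem contDiff_potential (hΦ : ContDiff ℝ 2 Φ) : ContDiff ℝ 2 (potential c Φ) :=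
  contDiff_const.mul (hΦ.comp contDiff_pos)

theorem grad_potential (hΦ : ContDiff ℝ 2 Φ) (y : Phase) :
    grad (potential c Φ) y = Sum.elim (c • grad Φ (pos y)) (0 : Vec3) := by
  have h1 := hΦ.differentiable two_ne_zero (pos y)
  funext i
  change fderiv ℝ (fun z => c * Φ (pos z)) y (Pi.single i 1) = _
  rw [fderiv_comp_pos (g := fun q => c * Φ q) (h1.const_mul c), fderiv_const_mul h1]
  rcases i with i | i
  · simp [pos_single_inl, grad]
  · simp [pos_single_inr]

theorem isPoissonSystem_kinetic (hm : 0 < m) (hb : ContDiff ℝ 1 b)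
    (hdiv : ∀ q, divergence b q = 0) :
    IsPoissonSystem (structureMatrix m c b) (kinetic m) (fieldT m + fieldB m c b) where
  tensor := isPoissonTensor_structureMatrix hb hdiv
  differentiable := (contDiff_kinetic (n := 1)).differentiable one_ne_zero
  eq y := by
    rw [grad_kinetic, structureMatrix, Matrix.fromBlocks_mulVec]
    funext i
    rcases i with i | i
    · simp [fieldT, fieldB]
    · simp [fieldT, fieldB, Matrix.mulVec_smul, Matrix.smul_mulVec, hm.ne']

theorem isPoissonSystem_potential (hb : ContDiff ℝ 1 b)
    (hdiv : ∀ q, divergence b q = 0) (hΦ : ContDiff ℝ 2 Φ) :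
    IsPoissonSystem (structureMatrix m c b) (potential c Φ) (fieldE c Φ) where
  tensor := isPoissonTensor_structureMatrix hb hdiv
  differentiable := (contDiff_potential hΦ).differentiable two_ne_zero
  eq y := by
    rw [grad_potential hΦ, structureMatrix, Matrix.fromBlocks_mulVec]
    funext i
    rcases i with i | i
    · simp [fieldE]
    · simp [fieldE, force, Matrix.neg_mulVec]

/-- Under `ℰ` the position is constant and the momentum is affine in time. -/
theorem exists_solution_fieldE (y : Phase) :
    ∃ α : ℝ → Phase, α 0 = y ∧ ∀ t, HasDerivAt α (fieldE c Φ (α t)) t := by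
  refine ⟨fun t => y + t • fieldE c Φ y, by simp, fun t => ?_⟩
  have hpos : pos (y + t • fieldE c Φ y) = pos y := by
    funext i
    simp [pos, fieldE]
  have h1 : fieldE c Φ (y + t • fieldE c Φ y) = fieldE c Φ y := by
    simp only [fieldE] at hpos ⊢
    rw [hpos]
  rw [h1]
  simpa using ((hasDerivAt_id t).smul_const (fieldE c Φ y)).const_add y

/-- The magnetic force is orthogonal to the momentum. -/
theorem mom_dotProduct_Omega (q p : Vec3) : ∑ i, p i * (Omega m c b q *ᵥ p) i = 0 := by
  simp [Omega, Matrix.mulVec, dotProduct, Fin.sum_univ_three]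
  ring

/-- Under `𝒯 + ℬ` the magnetic force does no work, so that `|p|` is constant and `q` grows at most
linearly. Both facts persist when the argument of the field is scaled, which is the a priori bound
that gives global solutions. -/
theorem exists_solution_fieldTB (hm : 0 < m)
    (hX : ContDiff ℝ 1 (fieldT m + fieldB m c b)) (y : Phase) :
    ∃ α : ℝ → Phase, α 0 = y ∧ ∀ t, HasDerivAt α ((fieldT m + fieldB m c b) (α t)) t := by
  refine exists_global_solution hX fun T hT => ?_
  have h0 : (0 : ℝ) ∈ Icc (-T) T := ⟨by linarith, hT.le⟩
  let P := Real.sqrt (∑ i, mom y i ^ 2)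
  have hP : 0 ≤ P := Real.sqrt_nonneg _
  refine exists_solution_of_apriori_bound (f := fun _ => fieldT m + fieldB m c b) h0
    (fun _ => continuous_const)
    (fun R => (exists_lipschitzOnWith_closedBall hX R).imp fun K hK _ _ => hK)
    (‖y‖ + m⁻¹ * P * T + P) fun α κ hκ hα0 hα => ?_
  have hpos : ∀ t ∈ Icc (-T) T, ∀ i, HasDerivWithinAt (fun s => α s (Sum.inl i))
      (m⁻¹ * (κ t * α t (Sum.inr i))) (Icc (-T) T) t := fun t ht i => by
    simpa [fieldT, fieldB, mom] using hasDerivWithinAt_pi.1 (hα t ht) (Sum.inl i)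
  have hmom : ∀ t ∈ Icc (-T) T, ∀ i, HasDerivWithinAt (fun s => α s (Sum.inr i))
      (κ t * (Omega m c b (pos (κ t • α t)) *ᵥ mom (α t)) i) (Icc (-T) T) t := fun t ht i => by
    have h1 : mom (κ t • α t) = κ t • mom (α t) := rfl
    simpa [fieldT, fieldB, h1, Matrix.mulVec_smul] using
      hasDerivWithinAt_pi.1 (hα t ht) (Sum.inr i)
  have henergy : ∀ t ∈ Icc (-T) T, ∑ i, mom (α t) i ^ 2 = ∑ i, mom y i ^ 2 := by
    have hd : ∀ t ∈ Icc (-T) T, HasDerivWithinAt (fun s => ∑ i, mom (α s) i ^ 2) 0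
        (Icc (-T) T) t := fun t ht => by
      have h1 := HasDerivWithinAt.fun_sum (u := Finset.univ) fun i _ => (hmom t ht i).fun_pow 2
      convert! h1 using 1
      have h2 := mom_dotProduct_Omega (m := m) (c := c) (b := b) (pos (κ t • α t)) (mom (α t))
      calc (0 : ℝ) = 2 * κ t * ∑ i, mom (α t) i *
            (Omega m c b (pos (κ t • α t)) *ᵥ mom (α t)) i := by rw [h2, mul_zero]
        _ = _ := by
          rw [Finset.mul_sum]
          refine Finset.sum_congr rfl fun i _ => ?_
          simp only [mom]
          push_cast
          ring
    intro t ht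
    have h1 := (convex_Icc (-T) T).norm_image_sub_le_of_norm_hasDerivWithin_le (C := 0) hd
      (fun _ _ => by simp) h0 ht
    rw [zero_mul, norm_le_zero_iff, sub_eq_zero, hα0] at h1
    exact h1
  have hmomP : ∀ t ∈ Icc (-T) T, ∀ i, |α t (Sum.inr i)| ≤ P := fun t ht i => by
    refine Real.abs_le_sqrt ?_
    rw [← henergy t ht]
    exact Finset.single_le_sum (f := fun i => mom (α t) i ^ 2) (fun i _ => sq_nonneg _)
      (Finset.mem_univ i)
  have hm' : 0 < m⁻¹ := inv_pos.2 hm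
  intro t ht
  refine (pi_norm_le_iff_of_nonneg (by positivity)).2 fun i => ?_
  rcases i with i | i
  · have h1 := (convex_Icc (-T) T).norm_image_sub_le_of_norm_hasDerivWithin_le (C := m⁻¹ * P)
      (fun s hs => hpos s hs i) (fun s hs => by
        rw [norm_mul, norm_mul, Real.norm_of_nonneg hm'.le, Real.norm_of_nonneg (hκ s).1]
        refine mul_le_mul_of_nonneg_left ?_ hm'.le
        exact (mul_le_of_le_one_left (norm_nonneg _) (hκ s).2).trans (hmomP s hs i)) h0 ht
    have h2 : ‖t - 0‖ ≤ T := by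
      rw [sub_zero]; exact abs_le.2 ⟨ht.1, ht.2⟩
    have h3 : m⁻¹ * P * ‖t - 0‖ ≤ m⁻¹ * P * T := by gcongr
    have h4 : ‖α t (Sum.inl i)‖ ≤ ‖α t (Sum.inl i) - α 0 (Sum.inl i)‖ + ‖α 0 (Sum.inl i)‖ :=
      norm_le_norm_sub_add _ _
    have h5 : ‖α 0 (Sum.inl i)‖ ≤ ‖y‖ := by rw [hα0]; exact norm_le_pi_norm y _
    linarith
  · have h1 : ‖α t (Sum.inr i)‖ ≤ P := hmomP t ht i
    have h2 : 0 ≤ m⁻¹ * P * T := by positivity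
    linarith [norm_nonneg y]

end Particle

end ChargedParticle

open ChargedParticle

theorem mainTheorem1 (m c : ℝ) (hm : 0 < m)
    (b : ChargedParticle.Vec3 → ChargedParticle.Vec3) (hb : ContDiff ℝ 1 b)
    (hdiv : ∀ q, ChargedParticle.divergence b q = 0)
    (Φ : ChargedParticle.Vec3 → ℝ) (hΦ : ContDiff ℝ 2 Φ) :
    -- the flow of every Poisson system consists of Poisson maps
    (∀ (ι : Type) [Fintype ι] [DecidableEq ι] (B : (ι → ℝ) → Matrix ι ι ℝ) (H : (ι → ℝ) → ℝ)
      (X : (ι → ℝ) → (ι → ℝ)) (φ : ℝ → (ι → ℝ) → (ι → ℝ)) (U : Set (ι → ℝ)) (t : ℝ),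
      (∀ i j, ContDiff ℝ 1 (fun y => B y i j)) → ContDiff ℝ 2 H →
      ChargedParticle.IsPoissonSystem B H X → IsOpen U →
      ChargedParticle.IsExactFlowUpTo X φ U t →
      ∀ y ∈ U, ChargedParticle.IsPoissonMapAt B (φ t) y) ∧
    -- the two parts of the splitting are Poisson systems for the two sub-Hamiltonians
    ChargedParticle.IsPoissonSystem (ChargedParticle.structureMatrix m c b)
      (ChargedParticle.kinetic m)
      (ChargedParticle.fieldT m + ChargedParticle.fieldB m c b) ∧
    ChargedParticle.IsPoissonSystem (ChargedParticle.structureMatrix m c b)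
      (ChargedParticle.potential c Φ) (ChargedParticle.fieldE c Φ) ∧
    -- their exact flows exist for all times and are unique
    (∃! φTB, ChargedParticle.IsExactFlow
      (ChargedParticle.fieldT m + ChargedParticle.fieldB m c b) φTB) ∧
    (∃! φE, ChargedParticle.IsExactFlow (ChargedParticle.fieldE c Φ) φE) ∧
    -- the subflows are Poisson maps; the Strang composition is time-symmetric and a Poisson map
    ∀ φTB φE : ℝ → ChargedParticle.Phase → ChargedParticle.Phase,
      ChargedParticle.IsExactFlow
        (ChargedParticle.fieldT m + ChargedParticle.fieldB m c b) φTB →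
      ChargedParticle.IsExactFlow (ChargedParticle.fieldE c Φ) φE →
      (∀ h, ChargedParticle.IsPoissonMap (ChargedParticle.structureMatrix m c b) (φTB h)) ∧
      (∀ h, ChargedParticle.IsPoissonMap (ChargedParticle.structureMatrix m c b) (φE h)) ∧
      ChargedParticle.IsTimeSymmetric (ChargedParticle.strang φE φTB) ∧
      (∀ h, ChargedParticle.IsPoissonMap (ChargedParticle.structureMatrix m c b)
        (ChargedParticle.strang φE φTB h)) := by
  have hB := contDiff_structureMatrix (m := m) (c := c) hb
  have hTB := isPoissonSystem_kinetic (c := c) hm hb hdiv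
  have hE := isPoissonSystem_potential (m := m) (c := c) hb hdiv hΦ
  have hXTB := hTB.contDiff hB contDiff_kinetic
  have hXE := hE.contDiff hB (contDiff_potential hΦ)
  refine ⟨fun ι _ _ B H X φ U t hB hH h hU hφ y hy => isPoissonMapAt_flow hB hH h hU hφ hy,
    hTB, hE, existsUnique_isExactFlow hXTB (exists_solution_fieldTB hm hXTB),
    existsUnique_isExactFlow hXE exists_solution_fieldE, fun φTB φE hφTB hφE => ?_⟩
  have hmapTB : ∀ h, IsPoissonMap (structureMatrix m c b) (φTB h) := fun h y =>
    isPoissonMapAt_flow hB contDiff_kinetic hTB isOpen_univ (hφTB.upTo h) (Set.mem_univ y)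
  have hmapE : ∀ h, IsPoissonMap (structureMatrix m c b) (φE h) := fun h y =>
    isPoissonMapAt_flow hB (contDiff_potential hΦ) hE isOpen_univ (hφE.upTo h) (Set.mem_univ y)
  exact ⟨hmapTB, hmapE, isTimeSymmetric_strang (hφE.leftInverse hXE) (hφTB.leftInverse hXTB),
    fun h => (hmapE _).comp ((hmapTB h).comp (hmapE _))⟩
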